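/- Let $\Gamma=(G,\sigma)$ be a connected balanced signed graph ($G$ a finite simple graph with vertices $1,\dots,n$, $\sigma:E(G)\to\{1,-1\}$, every cycle having an even number of negative edges) with exactly one cycle $C$, of length $|C|$. Let $N=[\eta(v,e)]$ be an incidence matrix of $\Gamma$: $\eta(v,e)=0$ if $v\notin e$, and $\eta(u,e),\eta(v,e)\in\{1,-1\}$ with $\eta(u,e)\eta(v,e)=-\sigma(e)$ if $e=\{u,v\}$. Let $N^\dagger$ be its Moore–Penrose inverse, i.e. the unique real matrix $X$ with $NXN=N$, $XNX=X$, and $NX$, $XN$ symmetric. Notation. The head and the tail of an edge $e$ are its larger and smaller end if $\sigma(e)=-1$, and the ends $v$ with $\eta(v,e)=-1$ and with $\eta(v,e)=1$, respectively, if $\sigma(e)=1$. Put $w(e)=-1$ if $\sigma(e)=-1$ and $\eta(v,e)=-1$ at both ends $v$ of $e$, and $w(e)=1$ otherwise. For $e_k\in E(C)$ let $T_k=G\setminus e_k$, a spanning tree. For an edge $e\ne e_k$, $T_h^{T_k}(e)$ and $T_t^{T_k}(e)$ are the vertex sets of the components of $T_k\setminus e$ containing the head and the tail of $e$, and $$\phi_{T_k}(e,j)=\begin{cases}|T_h^{T_k}(e)|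 & \text{if } j\in T_t^{T_k}(e),\\ -\sigma(e)\,|T_t^{T_k}(e)| & \text{if } j\in T_h^{T_k}(e).\end{cases}$$ For an edge $e\notin E(C)$, $G\setminus e[C]$ and $G\setminus e(C)$ are the components of $G\setminus e$ that contain, respectively do not contain, $C$. For a subgraph $H$, $P^H_{e-j}$ is a shortest path in $H$ between $e$ and the vertex $j$ (from an end of $e$ to $j$) that does not contain $e$, and $\operatorname{sgn}(P^H_{e-j})$ is the product of the signs of its edges. Then the following holds. (a) If $e\notin E(C)$ and $j\in G\setminus e[C]$, then either $j\in T_h^{T_k}(e)$ for all $e_k\in E(C)$, or $j\in T_t^{T_k}(e)$ for all $e_k\in E(C)$ (and not both). (b) If $e\notin E(C)$ or $\sigma(e)=1$, then $\operatorname{sgn}(P^G_{e-j})$ does not depend on the choice of the shortest path. If $e\notin E(C)$, then $$(N^\dagger)_{e,j}=\frac{w(e)\operatorname{sgn}(P^G_{e-j})}{n|C|}\cdot\begin{cases} |C|\,|G\setminus e(C)| & \text{if } j\in G\setminus e[C],\ j\in T_t^{T_k}(e)\text{ for some } e_k\in E(C),\\ -\sigma(e)\,|C|\,|G\setminus e(C)|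 & \text{if } j\in G\setminus e[C],\ j\in T_h^{T_k}(e)\text{ for some } e_k\in E(C),\\ |C|\,|G\setminus e[C]| & \text{if } j\in G\setminus e(C),\ j\in T_t^{T_k}(e)\text{ for some } e_k\in E(C),\\ -\sigma(e)\,|C|\,|G\setminus e[C]| & \text{if } j\in G\setminus e(C),\ j\in T_h^{T_k}(e)\text{ for some } e_k\in E(C). \end{cases}$$ If $e\in E(C)$, then for every vertex $j$ $$(N^\dagger)_{e,j}=\frac{w(e)}{n|C|}\sum_{e_k\in E(C),\ e_k\neq e}\operatorname{sgn}(P^{T_k}_{e-j})\,\phi_{T_k}(e,j),$$ and if moreover $\sigma(e)=1$, then $$(N^\dagger)_{e,j}=\frac{w(e)\operatorname{sgn}(P^{G}_{e-j})}{n|C|}\sum_{e_k\in E(C),\ e_k\neq e}\phi_{T_k}(e,j).$$ -/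

import Mathlib

/-! Signed graphs: a simple graph `G` on a linearly ordered vertex set `V` with a signature
`σ : Sym2 V → ℤˣ`; only the values of `σ` on the edges of `G` matter. -/

namespace SignedGraph

/-- The cycle (or walk) has an even number of negative edges. -/
def IsBalancedWalk {V : Type*} {G : SimpleGraph V} (σ : Sym2 V → ℤˣ) {u v : V}
    (p : G.Walk u v) : Prop :=
  Even (p.edges.countP (fun e => decide (σ e = -1)))

/-- A signed graph is balanced if all its cycles are balanced. -/
def IsBalanced {V : Type*} (G : SimpleGraph V) (σ : Sym2 V → ℤˣ) : Prop :=
  ∀ (v : V) (c : G.Walk v v), c.IsCycle → IsBalancedWalk σ c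

/-- `C` is a cycle of `G`, and it is the only one: every cycle of `G` has the same edges. -/
def IsUniqueCycle {V : Type*} {G : SimpleGraph V} {c₀ : V} (C : G.Walk c₀ c₀) : Prop :=
  C.IsCycle ∧ ∀ (v : V) (c : G.Walk v v), c.IsCycle → ∀ e, e ∈ c.edges ↔ e ∈ C.edges

/-- `N` is an incidence matrix of `(G, σ)`: rows are indexed by vertices, columns by edges. An
entry `-1` (resp. `1`) at `(v, e)` is an arrow of the bidirected edge `e` into (resp. out of)
`v`. -/
structure IsIncidenceMatrix {V : Type*} (G : SimpleGraph V) (σ : Sym2 V → ℤˣ)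
    (N : Matrix V G.edgeSet ℝ) : Prop where
  eq_zero : ∀ (v : V) (e : G.edgeSet), v ∉ e.1 → N v e = 0
  eq_one_or : ∀ (v : V) (e : G.edgeSet), v ∈ e.1 → N v e = 1 ∨ N v e = -1
  mul_eq : ∀ (u v : V) (e : G.edgeSet), e.1 = s(u, v) → N u e * N v e = -((σ e.1 : ℤ) : ℝ)

/-- The four Penrose equations: `X` is the Moore-Penrose inverse of the real matrix `A`. -/
structure IsMoorePenroseInverse {m n : Type*} [Fintype m] [Fintype n]
    (A : Matrix m n ℝ) (X : Matrix n m ℝ) : Prop where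
  mul_mul_left : A * X * A = A
  mul_mul_right : X * A * X = X
  symm_left : (A * X).transpose = A * X
  symm_right : (X * A).transpose = X * A

/-- `w(e)` is `-1` if `e` is a negative edge with both negative ends and `1` otherwise. -/
noncomputable def edgeWeight {V : Type*} {G : SimpleGraph V} (σ : Sym2 V → ℤˣ)
    (N : Matrix V G.edgeSet ℝ) (e : G.edgeSet) : ℝ :=
  open Classical in
  if σ e.1 = -1 ∧ ∀ v ∈ e.1, N v e = -1 then -1 else 1

/-- `v` is the head of `e`: the larger end if `e` is negative; the end that the arrows of `e` are
directed to (entry `-1`) if `e` is positive. -/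
def IsHead {V : Type*} [LinearOrder V] {G : SimpleGraph V} (σ : Sym2 V → ℤˣ)
    (N : Matrix V G.edgeSet ℝ) (e : G.edgeSet) (v : V) : Prop :=
  v ∈ e.1 ∧ ((σ e.1 = -1 ∧ ∀ u ∈ e.1, u ≤ v) ∨ (σ e.1 = 1 ∧ N v e = -1))

/-- `v` is the tail of `e`: the smaller end if `e` is negative; the end that the arrows of `e`
leave (entry `1`) if `e` is positive. -/
def IsTail {V : Type*} [LinearOrder V] {G : SimpleGraph V} (σ : Sym2 V → ℤˣ)
    (N : Matrix V G.edgeSet ℝ) (e : G.edgeSet) (v : V) : Prop :=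
  v ∈ e.1 ∧ ((σ e.1 = -1 ∧ ∀ u ∈ e.1, v ≤ u) ∨ (σ e.1 = 1 ∧ N v e = 1))

/-- `T_h(e)`: the vertices of the component of `T ∖ e` that contains the head of `e`. -/
def headComp {V : Type*} [LinearOrder V] {G : SimpleGraph V} (σ : Sym2 V → ℤˣ)
    (N : Matrix V G.edgeSet ℝ) (T : SimpleGraph V) (e : G.edgeSet) : Set V :=
  {j | ∃ v, IsHead σ N e v ∧ (T.deleteEdges {e.1}).Reachable v j}

/-- `T_t(e)`: the vertices of the component of `T ∖ e` that contains the tail of `e`. -/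
def tailComp {V : Type*} [LinearOrder V] {G : SimpleGraph V} (σ : Sym2 V → ℤˣ)
    (N : Matrix V G.edgeSet ℝ) (T : SimpleGraph V) (e : G.edgeSet) : Set V :=
  {j | ∃ v, IsTail σ N e v ∧ (T.deleteEdges {e.1}).Reachable v j}

/-- `φ_T(e, j)`. -/
noncomputable def treeTerm {V : Type*} [LinearOrder V] {G : SimpleGraph V}
    (σ : Sym2 V → ℤˣ) (N : Matrix V G.edgeSet ℝ) (T : SimpleGraph V) (e : G.edgeSet)
    (j : V) : ℝ :=
  open Classical in
  if j ∈ tailComp σ N T e then ((headComp σ N T e).ncard : ℝ)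
  else if j ∈ headComp σ N T e then
    -((σ e.1 : ℤ) : ℝ) * ((tailComp σ N T e).ncard : ℝ)
  else 0

/-- `G ∖ e [C]` for an edge `e` outside the cycle `C`: the vertices of the component of `G ∖ e`
that contains `C`. -/
def cycleSide {V : Type*} {G : SimpleGraph V} {c₀ : V} (C : G.Walk c₀ c₀)
    (e : G.edgeSet) : Set V :=
  {j | ∃ u ∈ C.support, (G.deleteEdges {e.1}).Reachable u j}

/-- `G ∖ e (C)` for an edge `e` outside the cycle `C`: the vertices of the component of `G ∖ e`
that does not contain `C` (for `G` connected, `G ∖ e` has exactly two components). -/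
def farSide {V : Type*} {G : SimpleGraph V} {c₀ : V} (C : G.Walk c₀ c₀)
    (e : G.edgeSet) : Set V :=
  {j | ∀ u ∈ C.support, ¬ (G.deleteEdges {e.1}).Reachable u j}

/-- The sign of a walk: the product of the signs of its edges. -/
def walkSign {V : Type*} {H : SimpleGraph V} (σ : Sym2 V → ℤˣ) {u v : V}
    (p : H.Walk u v) : ℤˣ :=
  (p.edges.map σ).prod

/-- `p` is a path in `H` from an end of `e` to `j` that does not contain `e`. -/
def IsPathFromEdge {V : Type*} (H : SimpleGraph V) (e : Sym2 V) (j : V) {u : V}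
    (p : H.Walk u j) : Prop :=
  u ∈ e ∧ p.IsPath ∧ e ∉ p.edges

/-- `p` is a shortest path in `H` between `e` and `j` that does not contain `e`. -/
def IsShortestPathFromEdge {V : Type*} (H : SimpleGraph V) (e : Sym2 V) (j : V) {u : V}
    (p : H.Walk u j) : Prop :=
  IsPathFromEdge H e j p ∧
    ∀ (u' : V) (q : H.Walk u' j), IsPathFromEdge H e j q → p.length ≤ q.length

/-- `sgn(P_{e-j})`, the path `P_{e-j}` being in `H` (and `0` if there is no such path). -/
noncomputable def edgePathSign {V : Type*} (σ : Sym2 V → ℤˣ) (H : SimpleGraph V)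
    (e : Sym2 V) (j : V) : ℝ :=
  open Classical in
  if h : ∃ (u : V) (p : H.Walk u j), IsShortestPathFromEdge H e j p then
    ((walkSign σ h.choose_spec.choose : ℤ) : ℝ)
  else 0

end SignedGraph

namespace SignedGraph

/-! ### Spanning trees of a unicyclic graph and the components left by deleting edges. -/

section Graph

variable {V : Type*} {G H : SimpleGraph V}

/-! Balance gives a switching `s : V → {±1}` with `σ(uv) = s(u) s(v)`. With `S = diag(s)`, the
matrix `M = S N` is the incidence matrix of an orientation of `G`. Since `S` is symmetric and
orthogonal, `N† = M† S`, and every path sign becomes a product of two values of `s`.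

For `M`, each spanning tree `T_k` gives a candidate inverse (`treeInverse`) with row `k` zero and
row `e` the centred indicator of the source side of `T_k ∖ e`. It satisfies `M X = 1 - J/n`
(`IsOriented.mul_treeInverse`), `J` being the all-ones matrix, and its rows sum to zero; this gives
every Penrose equation except the symmetry of `X M`. Averaging over the edges `k` of the cycle
supplies that symmetry: an off-diagonal entry `(e, f)` of the sum of the `X M` gets a contribution
only from `k = f`, with both edges on the cycle, and this contribution is symmetric in `e` and `f`
(`IsOriented.treeInverse_mul_apply_comm`).

The formulas are this average read entrywise: for `j` on the side of the end `x` of `e`, the entry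
for one tree is `N x e · s x · s j · |other side| / n` (`treeInverse_mul_switching`). Off the cycle
the two sides do not depend on `k`, so the average collapses. -/

lemma reachable_deleteEdges_or (hH : H.Preconnected) (x y j : V) :
    (H.deleteEdges {s(x, y)}).Reachable x j ∨ (H.deleteEdges {s(x, y)}).Reachable y j := by
  obtain ⟨p⟩ := hH j x
  suffices ∀ {j z : V}, H.Walk j z → z = x → (H.deleteEdges {s(x, y)}).Reachable x j ∨
      (H.deleteEdges {s(x, y)}).Reachable y j from this p rfl
  clear p j
  intro j z p hz
  induction p with
  | nil => exact .inl (hz ▸ .rfl)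
  | @cons a b _ hab p ih =>
    by_cases h : s(a, b) = s(x, y)
    · rcases Sym2.eq_iff.1 h with ⟨rfl, rfl⟩ | ⟨rfl, rfl⟩
      · exact .inl .rfl
      · exact .inr .rfl
    · have hba : (H.deleteEdges {s(x, y)}).Reachable b a :=
        (SimpleGraph.Adj.reachable (by simpa using ⟨hab, by simpa using h⟩)).symm
      exact (ih hz).imp (fun h => h.trans hba) (fun h => h.trans hba)

/-- The rest of the cycle is a detour around `k`. -/
lemma reachable_deleteEdges_iff_of_mem_cycle {c₀ : V} {c : H.Walk c₀ c₀} (hc : c.IsCycle)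
    {k : Sym2 V} (hk : k ∈ c.edges) {a b : V} :
    (H.deleteEdges {k}).Reachable a b ↔ H.Reachable a b := by
  refine ⟨fun h => h.mono (H.deleteEdges_le _), fun h => ?_⟩
  obtain ⟨p⟩ := h
  induction p with
  | nil => exact .rfl
  | @cons a b _ hab p ih =>
    refine SimpleGraph.Reachable.trans ?_ ih
    by_cases h : s(a, b) = k
    · subst h
      exact (SimpleGraph.adj_and_reachable_delete_edges_iff_exists_cycle.2 ⟨_, c, hc, hk⟩).2
    · exact SimpleGraph.Adj.reachable (by simpa using ⟨hab, by simpa using h⟩)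

lemma IsUniqueCycle.exists_mem_edges {c₀ : V} {C : G.Walk c₀ c₀} (hC : IsUniqueCycle C) :
    ∃ k, k ∈ C.edges := by
  apply List.exists_mem_of_length_pos
  rw [SimpleGraph.Walk.length_edges]
  have := hC.1.three_le_length
  omega

/-- The cycle survives in `G ∖ e`, so `k` is not a bridge there. Hence the components of `T_k ∖ e`
do not depend on `k`. -/
lemma IsUniqueCycle.reachable_deleteEdges_deleteEdges_iff {c₀ : V} {C : G.Walk c₀ c₀}
    (hC : IsUniqueCycle C) {e k : Sym2 V} (he : e ∉ C.edges) (hk : k ∈ C.edges) {a b : V} :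
    ((G.deleteEdges {k}).deleteEdges {e}).Reachable a b ↔ (G.deleteEdges {e}).Reachable a b := by
  have hcyc : (C.toDeleteEdge e he).IsCycle := SimpleGraph.Walk.IsCycle.toDeleteEdges G _ hC.1 _
  rw [SimpleGraph.deleteEdges_deleteEdges, Set.union_comm, ← SimpleGraph.deleteEdges_deleteEdges]
  exact reachable_deleteEdges_iff_of_mem_cycle hcyc (by simpa using hk)

/-- A cycle of `G ∖ k` would also be a cycle of `G`, and by uniqueness it would use `k`. -/
lemma IsUniqueCycle.isTree_deleteEdges {c₀ : V} {C : G.Walk c₀ c₀} (hC : IsUniqueCycle C)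
    (hG : G.Connected) {k : Sym2 V} (hk : k ∈ C.edges) : (G.deleteEdges {k}).IsTree := by
  have := hG.nonempty
  refine ⟨⟨fun a b => ?_⟩, fun v c hc => ?_⟩
  · exact (reachable_deleteEdges_iff_of_mem_cycle hC.1 hk).2 (hG a b)
  · have hk' := (hC.2 v _ (hc.mapLe (G.deleteEdges_le {k})) k).2 hk
    rw [SimpleGraph.Walk.edges_mapLe_eq_edges] at hk'
    simpa using c.edges_subset_edgeSet hk'

lemma not_reachable_deleteEdges (hH : H.IsAcyclic) {x y : V} (h : H.Adj x y) :
    ¬ (H.deleteEdges {s(x, y)}).Reachable x y :=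
  SimpleGraph.isAcyclic_iff_forall_adj_isBridge.1 hH h

/-- Deleting an edge of a tree leaves exactly two components. -/
lemma reachable_deleteEdges_iff_not (hH : H.IsTree) {x y : V} (h : H.Adj x y) (j : V) :
    (H.deleteEdges {s(x, y)}).Reachable y j ↔ ¬ (H.deleteEdges {s(x, y)}).Reachable x j :=
  ⟨fun hy hx => not_reachable_deleteEdges hH.isAcyclic h (hx.trans hy.symm),
    (reachable_deleteEdges_or hH.connected.preconnected x y j).resolve_left⟩

end Graph

/-! ### Switching functions and signs of paths. -/

section Sign

variable {V : Type*} {G H : SimpleGraph V} {σ : Sym2 V → ℤˣ}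

@[simp] lemma walkSign_nil {v : V} : walkSign σ (SimpleGraph.Walk.nil : G.Walk v v) = 1 := by
  simp [walkSign]

@[simp] lemma walkSign_cons {u v w : V} (h : G.Adj u v) (p : G.Walk v w) :
    walkSign σ (.cons h p) = σ s(u, v) * walkSign σ p := by
  simp [walkSign]

@[simp] lemma walkSign_mapLe (h : H ≤ G) {u v : V} (p : H.Walk u v) :
    walkSign σ (p.mapLe h) = walkSign σ p := by
  simp [walkSign]

lemma prod_eq_neg_one_pow_countP (l : List ℤˣ) :
    l.prod = (-1) ^ l.countP (fun x => decide (x = -1)) := by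
  induction l with
  | nil => simp
  | cons a l ih =>
    rcases Int.units_eq_one_or a with rfl | rfl <;> simp [ih, pow_succ]

lemma IsBalancedWalk.walkSign_eq_one {u v : V} {p : G.Walk u v} (h : IsBalancedWalk σ p) :
    walkSign σ p = 1 := by
  rw [walkSign, prod_eq_neg_one_pow_countP, List.countP_map]
  exact h.neg_one_pow

lemma walkSign_eq_mul {s : V → ℤˣ} (hs : ∀ u v, G.Adj u v → σ s(u, v) = s u * s v) {u v : V}
    (p : G.Walk u v) : walkSign σ p = s u * s v := by
  induction p with
  | nil => simp
  | @cons a b c h p ih =>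
    rw [walkSign_cons, ih, hs _ _ h, mul_assoc, ← mul_assoc (s b), Int.units_mul_self, one_mul]

/-- The signs of the paths from a root are a switching function of a signed tree. -/
lemma exists_switching_of_isTree (hH : H.IsTree) (σ : Sym2 V → ℤˣ) :
    ∃ s : V → ℤˣ, ∀ u v, H.Adj u v → σ s(u, v) = s u * s v := by
  classical
  obtain ⟨r⟩ := hH.connected.nonempty
  choose p hp using fun v => hH.connected.exists_isPath v r
  have key : ∀ u v, H.Adj u v → v ∉ (p u).support →
      σ s(u, v) = walkSign σ (p u) * walkSign σ (p v) := by
    intro u v h hv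
    have h1 : (SimpleGraph.Walk.cons h.symm (p u)).IsPath := (hp u).cons hv
    have h2 : p v = SimpleGraph.Walk.cons h.symm (p u) :=
      (hH.existsUnique_path v r).unique (hp v) h1
    rw [h2, walkSign_cons, mul_left_comm, Int.units_mul_self, mul_one, Sym2.eq_swap]
  refine ⟨fun v => walkSign σ (p v), fun u v h => ?_⟩
  -- If `v` lies on the path from `u` to the root, then `u` is not on the path from `v`, so `key`
  -- applies with the ends exchanged.
  by_cases hv : v ∈ (p u).support
  · have hu : u ∉ (p v).support := by
      have := hH.isAcyclic.ne_mem_support_of_support_of_adj_of_isPath (hp u).reverse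
        (hp v).reverse h (by simpa using hv)
      simpa using this
    rw [Sym2.eq_swap, key v u h.symm hu, mul_comm]
  · exact key u v h hv

/-- A switching of the spanning tree `T_k` also works on `k`: the tree path between the ends of `k`
closes up with `k` to a cycle, whose sign is 1 by balance. -/
lemma IsUniqueCycle.exists_switching {c₀ : V} {C : G.Walk c₀ c₀} (hC : IsUniqueCycle C)
    (hG : G.Connected) (hbal : IsBalanced G σ) :
    ∃ s : V → ℤˣ, ∀ u v, G.Adj u v → σ s(u, v) = s u * s v := by
  obtain ⟨k, hk⟩ := hC.exists_mem_edges
  have hT := hC.isTree_deleteEdges hG hk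
  obtain ⟨s, hs⟩ := exists_switching_of_isTree hT σ
  refine ⟨s, fun u v h => ?_⟩
  by_cases hk' : s(u, v) = k
  · obtain ⟨p, hp⟩ := hT.connected.exists_isPath v u
    have hc : (SimpleGraph.Walk.cons h (p.mapLe (G.deleteEdges_le {k}))).IsCycle := by
      refine (SimpleGraph.Walk.cons_isCycle_iff _ _).2 ⟨hp.mapLe _, fun hmem => ?_⟩
      rw [SimpleGraph.Walk.edges_mapLe_eq_edges] at hmem
      simpa [hk'] using p.edges_subset_edgeSet hmem
    have h1 := (hbal _ _ hc).walkSign_eq_one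
    rw [walkSign_cons, walkSign_mapLe, walkSign_eq_mul hs] at h1
    rw [eq_comm, mul_comm, ← mul_one (s v * s u), ← h1, mul_left_comm, Int.units_mul_self, mul_one]
  · exact hs _ _ (by simpa using ⟨h, by simpa using hk'⟩)

lemma IsPathFromEdge.reachable {e : Sym2 V} {j u : V} {p : H.Walk u j}
    (h : IsPathFromEdge H e j p) : (H.deleteEdges {e}).Reachable u j :=
  ⟨p.toDeleteEdge e h.2.2⟩

lemma exists_isShortestPathFromEdge {e : Sym2 V} {x j : V} (hx : x ∈ e)
    (h : (H.deleteEdges {e}).Reachable x j) :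
    ∃ (u : V) (p : H.Walk u j), IsShortestPathFromEdge H e j p := by
  classical
  have hex : ∃ (n : ℕ) (u : V) (p : H.Walk u j), IsPathFromEdge H e j p ∧ p.length = n := by
    obtain ⟨p, hp⟩ := h.exists_isPath
    refine ⟨_, x, p.mapLe (H.deleteEdges_le {e}), ⟨hx, hp.mapLe _, fun hmem => ?_⟩, rfl⟩
    rw [SimpleGraph.Walk.edges_mapLe_eq_edges] at hmem
    simpa using p.edges_subset_edgeSet hmem
  obtain ⟨u, p, hp, hlen⟩ := Nat.find_spec hex
  exact ⟨u, p, hp, fun u' q hq => hlen ▸ Nat.find_min' hex ⟨u', q, hq, rfl⟩⟩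

/-- In a graph with a switching function `s`, the sign of every path from `e` to `j` that starts
in an end with the same value of `s` as `x` is `s x * s j`. -/
lemma edgePathSign_eq {s : V → ℤˣ} (hs : ∀ u v, H.Adj u v → σ s(u, v) = s u * s v)
    {e : Sym2 V} {x j : V} (hx : x ∈ e) (h : (H.deleteEdges {e}).Reachable x j)
    (huniq : ∀ u ∈ e, (H.deleteEdges {e}).Reachable u j → s u = s x) :
    edgePathSign σ H e j = ((s x * s j : ℤˣ) : ℤ) := by
  have hex := exists_isShortestPathFromEdge hx h
  have hp := hex.choose_spec.choose_spec.1
  rw [edgePathSign, dif_pos hex, walkSign_eq_mul hs, huniq _ hp.1 hp.reachable]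

end Sign

/-! ### Moore–Penrose inverses: uniqueness and orthogonal changes of rows. -/

section LinearAlgebra

open Matrix

lemma IsMoorePenroseInverse.unique {m n : Type*} [Fintype m] [Fintype n] {A : Matrix m n ℝ}
    {X Y : Matrix n m ℝ} (hX : IsMoorePenroseInverse A X) (hY : IsMoorePenroseInverse A Y) :
    Y = X := by
  have h1 : A * X = A * Y := by
    calc A * X = (A * Y * A) * X := by rw [hY.mul_mul_left]
      _ = (A * Y)ᵀ * (A * X)ᵀ := by rw [hY.symm_left, hX.symm_left, Matrix.mul_assoc]
      _ = (A * X * A * Y)ᵀ := by rw [← transpose_mul]; simp only [Matrix.mul_assoc]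
      _ = A * Y := by rw [hX.mul_mul_left, hY.symm_left]
  have h2 : X * A = Y * A := by
    calc X * A = X * (A * Y * A) := by rw [hY.mul_mul_left]
      _ = (X * A)ᵀ * (Y * A)ᵀ := by rw [hY.symm_right, hX.symm_right]; simp only [Matrix.mul_assoc]
      _ = (Y * (A * X * A))ᵀ := by rw [← transpose_mul]; simp only [Matrix.mul_assoc]
      _ = Y * A := by rw [hX.mul_mul_left, hY.symm_right]
  calc Y = Y * A * Y := hY.mul_mul_right.symm
    _ = X * A * X := by rw [← h2, Matrix.mul_assoc, ← h1, ← Matrix.mul_assoc]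
    _ = X := hX.mul_mul_right

/-- The factor `S` cancels in `X A` and conjugates `A X`, so both symmetries persist. -/
lemma IsMoorePenroseInverse.mul_isometry {m n : Type*} [Fintype m] [Fintype n] [DecidableEq m]
    {A : Matrix m n ℝ} {X : Matrix n m ℝ} (h : IsMoorePenroseInverse A X) {S : Matrix m m ℝ}
    (hS : S * S = 1) (hSt : Sᵀ = S) : IsMoorePenroseInverse (S * A) (X * S) := by
  have hXA : X * S * (S * A) = X * A := by
    rw [Matrix.mul_assoc, ← Matrix.mul_assoc S, hS, Matrix.one_mul]
  refine ⟨?_, ?_, ?_, ?_⟩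
  · rw [Matrix.mul_assoc, hXA, Matrix.mul_assoc, ← Matrix.mul_assoc A, h.mul_mul_left]
  · rw [hXA, ← Matrix.mul_assoc, h.mul_mul_right]
  · have : S * A * (X * S) = S * (A * X) * S := by simp only [Matrix.mul_assoc]
    rw [this, transpose_mul, transpose_mul, h.symm_left, hSt]
    simp only [Matrix.mul_assoc]
  · rw [hXA, h.symm_right]

end LinearAlgebra

/-! ### The Moore–Penrose inverse of an oriented unicyclic graph. -/

section Oriented

open Classical in
/-- For an edge `e ≠ k`, row `e` is the indicator function of the component of
`G ∖ k ∖ e` containing the source of `e`, shifted to have mean value zero. -/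
noncomputable def treeInverse {V : Type*} {G : SimpleGraph V} (src : G.edgeSet → V) (k : Sym2 V) :
    Matrix G.edgeSet V ℝ := fun e j =>
  if e.1 = k then 0 else
    (if ((G.deleteEdges {k}).deleteEdges {e.1}).Reachable (src e) j then 1 else 0) -
      ({i | ((G.deleteEdges {k}).deleteEdges {e.1}).Reachable (src e) i}.ncard : ℝ) / Nat.card V

/-- The average of `treeInverse src k` over the edges `k` of the closed walk `C`. -/
noncomputable def cycleInverse {V : Type*} [DecidableEq V] {G : SimpleGraph V}
    (src : G.edgeSet → V) {c₀ : V} (C : G.Walk c₀ c₀) : Matrix G.edgeSet V ℝ :=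
  (C.length : ℝ)⁻¹ • ∑ k ∈ C.edges.toFinset, treeInverse src k

/-- `M` is the incidence matrix of the orientation of `G` given by `src` and `tgt`. -/
structure IsOriented {V : Type*} [DecidableEq V] {G : SimpleGraph V} (src tgt : G.edgeSet → V)
    (M : Matrix V G.edgeSet ℝ) : Prop where
  edge_eq : ∀ e : G.edgeSet, e.1 = s(src e, tgt e)
  apply : ∀ v e, M v e = (if v = src e then 1 else 0) - (if v = tgt e then 1 else 0)

lemma IsUniqueCycle.length_ne_zero {V : Type*} {G : SimpleGraph V} {c₀ : V} {C : G.Walk c₀ c₀}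
    (hC : IsUniqueCycle C) : (C.length : ℝ) ≠ 0 := by
  have := hC.1.three_le_length
  simp only [ne_eq, Nat.cast_eq_zero]
  omega

lemma IsUniqueCycle.card_edges {V : Type*} [DecidableEq V] {G : SimpleGraph V} {c₀ : V}
    {C : G.Walk c₀ c₀} (hC : IsUniqueCycle C) : C.edges.toFinset.card = C.length := by
  rw [List.toFinset_card_of_nodup hC.1.isTrail.edges_nodup, SimpleGraph.Walk.length_edges]

lemma treeInverse_apply_self {V : Type*} {G : SimpleGraph V} {src : G.edgeSet → V} {k : Sym2 V}
    {e : G.edgeSet} (h : e.1 = k) (j : V) : treeInverse src k e j = 0 := by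
  simp [treeInverse, h]

variable {V : Type*} [DecidableEq V] {G : SimpleGraph V} {src tgt : G.edgeSet → V}
  {M : Matrix V G.edgeSet ℝ} {k : Sym2 V}

lemma IsOriented.adj (hM : IsOriented src tgt M) (e : G.edgeSet) : G.Adj (src e) (tgt e) := by
  have := e.2
  rwa [hM.edge_eq e] at this

lemma IsOriented.reachable_deleteEdges (hM : IsOriented src tgt M) {e f : G.edgeSet}
    (hk : f.1 ≠ k) (he : f ≠ e) :
    ((G.deleteEdges {k}).deleteEdges {e.1}).Reachable (src f) (tgt f) := by
  refine SimpleGraph.Adj.reachable ?_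
  have he' : f.1 ≠ e.1 := fun h => he (Subtype.ext h)
  rw [hM.edge_eq f] at hk he'
  simpa using ⟨hM.adj f, by simpa using he', by simpa using hk⟩

lemma IsOriented.reachable_tgt_iff_not (hM : IsOriented src tgt M)
    (hT : (G.deleteEdges {k}).IsTree) {e : G.edgeSet} (he : e.1 ≠ k) (j : V) :
    ((G.deleteEdges {k}).deleteEdges {e.1}).Reachable (tgt e) j ↔
      ¬ ((G.deleteEdges {k}).deleteEdges {e.1}).Reachable (src e) j := by
  rw [hM.edge_eq e] at he ⊢
  exact reachable_deleteEdges_iff_not hT (by simpa using ⟨hM.adj e, by simpa using he⟩) j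

variable [Fintype V]

lemma IsOriented.sum_mul (hM : IsOriented src tgt M) (f : V → ℝ) (e : G.edgeSet) :
    ∑ v, f v * M v e = f (src e) - f (tgt e) := by
  simp [hM.apply, mul_sub, Finset.sum_sub_distrib]

lemma IsOriented.sum_eq_zero (hM : IsOriented src tgt M) (e : G.edgeSet) :
    ∑ v, M v e = 0 := by
  simpa using hM.sum_mul 1 e

lemma IsOriented.mul_apply (hM : IsOriented src tgt M) (Y : Matrix G.edgeSet V ℝ)
    (e f : G.edgeSet) : (Y * M) e f = Y e (src f) - Y e (tgt f) := by
  rw [Matrix.mul_apply, hM.sum_mul]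

lemma sum_treeInverse [Nonempty V] (e : G.edgeSet) : ∑ j, treeInverse src k e j = 0 := by
  classical
  by_cases h : e.1 = k
  · simp [treeInverse_apply_self h]
  · simp only [treeInverse, h, if_false, Finset.sum_sub_distrib,
      Finset.sum_const, Finset.card_univ, nsmul_eq_mul, Nat.card_eq_fintype_card]
    rw [mul_div_cancel₀ _ (by simp), Set.ncard_eq_toFinset_card']
    simp

open Classical in
lemma IsOriented.treeInverse_mul_apply (hM : IsOriented src tgt M) {e : G.edgeSet}
    (h : e.1 ≠ k) (f : G.edgeSet) : (treeInverse src k * M) e f =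
      (if ((G.deleteEdges {k}).deleteEdges {e.1}).Reachable (src e) (src f) then 1 else 0) -
      (if ((G.deleteEdges {k}).deleteEdges {e.1}).Reachable (src e) (tgt f) then 1 else 0) := by
  rw [hM.mul_apply]
  simp [treeInverse, h]

/-- The entry is the jump of row `e` along `f`, and row `e` is constant on the components of `T_k ∖
e`. -/
lemma IsOriented.treeInverse_mul_apply_eq_zero (hM : IsOriented src tgt M) {e f : G.edgeSet}
    (hf : ((G.deleteEdges {k}).deleteEdges {e.1}).Reachable (src f) (tgt f)) :
    (treeInverse src k * M) e f = 0 := by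
  by_cases h : e.1 = k
  · simp [hM.mul_apply, treeInverse_apply_self h]
  · rw [hM.treeInverse_mul_apply h, sub_eq_zero]
    congr 1
    exact propext ⟨fun h => h.trans hf, fun h => h.trans hf.symm⟩

lemma IsOriented.treeInverse_mul_apply_self (hM : IsOriented src tgt M)
    (hT : (G.deleteEdges {k}).IsTree) {e : G.edgeSet} (he : e.1 ≠ k) :
    (treeInverse src k * M) e e = 1 := by
  have h := (hM.reachable_tgt_iff_not hT he (tgt e)).1 .rfl
  rw [hM.treeInverse_mul_apply he, if_pos .rfl, if_neg h, sub_zero]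

variable {c₀ : V} {C : G.Walk c₀ c₀}

/-- Both entries are read off the two components of `G ∖ {e, f}`, each of `e` and `f` joining one to
the other. So `src e` is with `tgt f` exactly when `src f` is with `tgt e`. -/
lemma IsOriented.treeInverse_mul_apply_comm (hM : IsOriented src tgt M) (hG : G.Connected)
    (hC : IsUniqueCycle C) {e f : G.edgeSet} (hef : e ≠ f) (he : e.1 ∈ C.edges)
    (hf : f.1 ∈ C.edges) :
    (treeInverse src f.1 * M) e f = (treeInverse src e.1 * M) f e := by
  have hef' : e.1 ≠ f.1 := fun h => hef (Subtype.ext h)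
  have h1 := hM.reachable_tgt_iff_not (hC.isTree_deleteEdges hG hf) hef'
  have h2 := hM.reachable_tgt_iff_not (hC.isTree_deleteEdges hG he) hef'.symm
  have hD : (G.deleteEdges {e.1}).deleteEdges {f.1} = (G.deleteEdges {f.1}).deleteEdges {e.1} := by
    rw [SimpleGraph.deleteEdges_deleteEdges, Set.union_comm, ← SimpleGraph.deleteEdges_deleteEdges]
  have hs : ((G.deleteEdges {f.1}).deleteEdges {e.1}).Reachable (src e) (src f) ↔
      ((G.deleteEdges {e.1}).deleteEdges {f.1}).Reachable (src f) (src e) := by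
    rw [hD, SimpleGraph.reachable_comm]
  have ht : ((G.deleteEdges {f.1}).deleteEdges {e.1}).Reachable (src e) (tgt f) ↔
      ((G.deleteEdges {e.1}).deleteEdges {f.1}).Reachable (src f) (tgt e) := by
    rw [← not_iff_not, ← h1, ← h2, hD, SimpleGraph.reachable_comm]
  rw [hM.treeInverse_mul_apply hef', hM.treeInverse_mul_apply hef'.symm]
  refine congrArg₂ (· - ·) ?_ ?_
  · split_ifs <;> tauto
  · split_ifs <;> tauto

/-- For `k ≠ f` the edge `f` survives in `T_k ∖ e`, so row `e` does not jump along it. For `k = f`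
and `e` off the cycle, the rest of the cycle still joins the ends of `f`. -/
lemma IsOriented.sum_treeInverse_mul_apply (hM : IsOriented src tgt M) (hC : IsUniqueCycle C)
    {e f : G.edgeSet} (hef : e ≠ f) :
    ∑ k ∈ C.edges.toFinset, (treeInverse src k * M) e f =
      if e.1 ∈ C.edges ∧ f.1 ∈ C.edges then (treeInverse src f.1 * M) e f else 0 := by
  have hz : ∀ k, k ≠ f.1 → (treeInverse src k * M) e f = 0 := fun k hk =>
    hM.treeInverse_mul_apply_eq_zero (hM.reachable_deleteEdges hk.symm hef.symm)
  by_cases hf : f.1 ∈ C.edges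
  · rw [Finset.sum_eq_single f.1 (fun k _ hk => hz k hk) (by simp [hf])]
    by_cases he : e.1 ∈ C.edges
    · simp [he, hf]
    · rw [if_neg (fun h => he h.1)]
      apply hM.treeInverse_mul_apply_eq_zero
      rw [hC.reachable_deleteEdges_deleteEdges_iff he hf]
      refine SimpleGraph.Adj.reachable ?_
      have he' : f.1 ≠ e.1 := fun h => hef (Subtype.ext h.symm)
      rw [hM.edge_eq f] at he'
      simpa using ⟨hM.adj f, by simpa using he'⟩
  · rw [if_neg (fun h => hf h.2)]
    refine Finset.sum_eq_zero fun k hk => hz k ?_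
    rintro rfl
    exact hf (List.mem_toFinset.1 hk)

variable [Fintype G.edgeSet]

lemma card_eq_card_edgeSet (hk : k ∈ G.edgeSet) (hT : (G.deleteEdges {k}).IsTree) :
    Fintype.card V = Fintype.card G.edgeSet := by
  classical
  have h := hT.card_edgeFinset
  rw [← h, ← SimpleGraph.edgeFinset_card]
  have h2 : (G.deleteEdges {k}).edgeFinset = G.edgeFinset.erase k := by
    ext e
    simp [and_comm]
  rw [h2, Finset.card_erase_add_one (by simpa using hk)]

/-- The incidence matrix of a tree, bordered by a constant column, is inverse to the matrix
`treeInverse`, bordered by a constant row. -/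
lemma IsOriented.mul_treeInverse (hM : IsOriented src tgt M) (hk : k ∈ G.edgeSet)
    (hT : (G.deleteEdges {k}).IsTree) :
    M * treeInverse src k = 1 - Matrix.of fun _ _ => (Fintype.card V : ℝ)⁻¹ := by
  have hne : Nonempty V := hT.connected.nonempty
  -- The slot of `k`, unused by the tree, holds the border. The matrices have as many rows as
  -- columns because `G` has as many edges as vertices, so a left inverse is a right inverse.
  let A : Matrix V G.edgeSet ℝ := fun v f => if f.1 = k then 1 else M v f
  let B : Matrix G.edgeSet V ℝ := fun f v =>
    if f.1 = k then (Fintype.card V : ℝ)⁻¹ else treeInverse src k f v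
  have hBA : B * A = 1 := by
    ext e f
    rw [Matrix.mul_apply]
    by_cases he : e.1 = k <;> by_cases hf : f.1 = k
    · have : e = f := Subtype.ext (he.trans hf.symm)
      subst this
      simp [A, B, he]
    · have : e ≠ f := fun h => hf (h ▸ he)
      simp [A, B, he, hf, ← Finset.mul_sum, hM.sum_eq_zero, this]
    · have : e ≠ f := fun h => he (h ▸ hf)
      simp [A, B, he, hf, sum_treeInverse, this]
    · simp only [A, B, he, hf, if_false]
      rw [← Matrix.mul_apply]
      by_cases hef : e = f
      · subst hef
        rw [hM.treeInverse_mul_apply_self hT he, Matrix.one_apply_eq]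
      · rw [hM.treeInverse_mul_apply_eq_zero (hM.reachable_deleteEdges hf (Ne.symm hef)),
          Matrix.one_apply_ne hef]
  have hAB : A * B = 1 :=
    (Matrix.mul_eq_one_comm_of_card_eq _ _ _ (card_eq_card_edgeSet hk hT)).2 hBA
  rw [← hAB]
  -- In `A * B` the index `k` contributes `1/n`; the other indices give `M * treeInverse src k`,
  -- whose own term at `k` is zero.
  ext i j
  rw [Matrix.sub_apply, Matrix.of_apply, Matrix.mul_apply, Matrix.mul_apply,
    ← Finset.sum_erase_add _ _ (Finset.mem_univ (⟨k, hk⟩ : G.edgeSet)),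
    ← Finset.sum_erase_add Finset.univ (fun f => A i f * B f j)
      (Finset.mem_univ (⟨k, hk⟩ : G.edgeSet)), treeInverse_apply_self (e := ⟨k, hk⟩) rfl]
  simp only [A, B, if_true, mul_zero, add_zero, one_mul, add_sub_cancel_right]
  refine Finset.sum_congr rfl fun f hf => ?_
  have : f.1 ≠ k := fun h => (Finset.mem_erase.1 hf).1 (Subtype.ext h)
  simp [this]

/-- The product for a single tree does not depend on `k`, so the average has the same product. -/
lemma IsOriented.mul_cycleInverse (hM : IsOriented src tgt M) (hG : G.Connected)
    (hC : IsUniqueCycle C) :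
    M * cycleInverse src C = 1 - Matrix.of fun _ _ => (Fintype.card V : ℝ)⁻¹ := by
  rw [cycleInverse, Matrix.mul_smul, Matrix.mul_sum, Finset.sum_congr rfl fun k hk =>
    hM.mul_treeInverse (C.edges_subset_edgeSet (List.mem_toFinset.1 hk))
      (hC.isTree_deleteEdges hG (List.mem_toFinset.1 hk)),
    Finset.sum_const, hC.card_edges, ← Nat.cast_smul_eq_nsmul ℝ, smul_smul,
    inv_mul_cancel₀ hC.length_ne_zero, one_smul]

lemma IsOriented.isMoorePenroseInverse_cycleInverse (hM : IsOriented src tgt M)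
    (hG : G.Connected) (hC : IsUniqueCycle C) :
    IsMoorePenroseInverse M (cycleInverse src C) := by
  have hne : Nonempty V := hG.nonempty
  have hMX := hM.mul_cycleInverse hG hC
  refine ⟨?_, ?_, ?_, ?_⟩
  · rw [hMX, Matrix.sub_mul, Matrix.one_mul, sub_eq_self]
    ext i e
    simp [Matrix.mul_apply, ← Finset.mul_sum, hM.sum_eq_zero]
  · rw [Matrix.mul_assoc, hMX, Matrix.mul_sub, Matrix.mul_one, sub_eq_self]
    ext e j
    simp only [cycleInverse, Matrix.mul_apply, Matrix.smul_apply, Matrix.sum_apply,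
      Matrix.of_apply, ← Finset.sum_mul, ← Finset.smul_sum]
    rw [Finset.sum_comm]
    simp [sum_treeInverse]
  · rw [hMX]
    ext i j
    simp [Matrix.one_apply, eq_comm]
  · ext e f
    rw [Matrix.transpose_apply]
    rcases eq_or_ne e f with rfl | hef
    · rfl
    · simp only [cycleInverse, Matrix.smul_mul, Matrix.sum_mul, Matrix.smul_apply,
        Matrix.sum_apply]
      rw [hM.sum_treeInverse_mul_apply hC hef, hM.sum_treeInverse_mul_apply hC hef.symm]
      congr 1
      by_cases he : e.1 ∈ C.edges <;> by_cases hf : f.1 ∈ C.edges <;> simp only [he, hf,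
        and_true, and_false, if_true, if_false]
      exact (hM.treeInverse_mul_apply_comm hG hC hef he hf).symm

end Oriented

/-! ### From the oriented inverse back to heads, tails, weights and path signs. -/

section Formula

variable {V : Type*} {G : SimpleGraph V} {σ : Sym2 V → ℤˣ} {N : Matrix V G.edgeSet ℝ}
  {s : V → ℤˣ} {src tgt : G.edgeSet → V} {k : Sym2 V}

lemma units_cast_mul_self (a : ℤˣ) : ((a : ℤ) : ℝ) * ((a : ℤ) : ℝ) = 1 := by
  rcases Int.units_eq_one_or a with rfl | rfl <;> simp

/-- Switching a balanced signed graph turns its incidence matrices into incidence matrices of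
orientations. -/
lemma IsIncidenceMatrix.exists_isOriented [Fintype V] [DecidableEq V]
    (hN : IsIncidenceMatrix G σ N) (hs : ∀ u v, G.Adj u v → σ s(u, v) = s u * s v) :
    ∃ src tgt : G.edgeSet → V,
      IsOriented src tgt (Matrix.diagonal (fun v => ((s v : ℤ) : ℝ)) * N) := by
  have key : ∀ e : G.edgeSet, ∃ a b : V, e.1 = s(a, b) ∧ a ≠ b ∧ (s a : ℤ) * N a e = 1 ∧
      (s b : ℤ) * N b e = -1 := by
    rintro ⟨⟨u, v⟩, huv⟩
    have hadj : G.Adj u v := huv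
    have h1 := hN.mul_eq u v ⟨s(u, v), huv⟩ rfl
    have hprod : ((s u : ℤ) * N u ⟨s(u, v), huv⟩) * ((s v : ℤ) * N v ⟨s(u, v), huv⟩) = -1 := by
      rw [mul_mul_mul_comm, h1, hs _ _ hadj]
      push_cast
      linear_combination (-((s v : ℤ) : ℝ) * (s v : ℤ)) * units_cast_mul_self (s u) -
        units_cast_mul_self (s v)
    have hu : (s u : ℤ) * N u ⟨s(u, v), huv⟩ = 1 ∨ (s u : ℤ) * N u ⟨s(u, v), huv⟩ = -1 := by
      rcases hN.eq_one_or u ⟨s(u, v), huv⟩ (by simp) with h | h <;>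
      rcases Int.units_eq_one_or (s u) with h' | h' <;> simp [h, h']
    rcases hu with hu | hu
    · rw [hu, one_mul] at hprod
      exact ⟨u, v, rfl, hadj.ne, hu, hprod⟩
    · rw [hu, neg_one_mul, neg_inj] at hprod
      exact ⟨v, u, Sym2.eq_swap, hadj.ne', hprod, hu⟩
  choose src tgt h1 h2 h3 h4 using key
  refine ⟨src, tgt, h1, fun v e => ?_⟩
  rw [Matrix.diagonal_mul]
  by_cases ha : v = src e
  · subst ha
    simp [h3, h2]
  · by_cases hb : v = tgt e
    · subst hb
      simp [h4, (h2 e).symm]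
    · rw [hN.eq_zero v e (by rw [h1 e]; simp [ha, hb])]
      simp [ha, hb]

lemma edgeWeight_of_pos {e : G.edgeSet} (h : σ e.1 = 1) : edgeWeight σ N e = 1 := by
  simp [edgeWeight, h]

/-- Every edge has a unique head and a unique tail; the entries of the incidence matrix there are
determined by the weight and the sign of the edge. -/
lemma IsIncidenceMatrix.exists_head_tail [LinearOrder V] (hN : IsIncidenceMatrix G σ N)
    (e : G.edgeSet) : ∃ h t : V, e.1 = s(t, h) ∧ (∀ v, IsHead σ N e v ↔ v = h) ∧
      (∀ v, IsTail σ N e v ↔ v = t) ∧ N t e = edgeWeight σ N e ∧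
      N h e = edgeWeight σ N e * -((σ e.1 : ℤ) : ℝ) := by
  rcases Int.units_eq_one_or (σ e.1) with hσ | hσ
  · obtain ⟨h, t, he, hh, ht⟩ : ∃ h t : V, e.1 = s(t, h) ∧ N h e = -1 ∧ N t e = 1 := by
      obtain ⟨⟨u, v⟩, huv⟩ := e
      have h1 := hN.mul_eq u v ⟨s(u, v), huv⟩ rfl
      change σ s(u, v) = 1 at hσ
      rw [hσ] at h1
      rcases hN.eq_one_or u ⟨s(u, v), huv⟩ (by simp) with h | h
      · exact ⟨v, u, rfl, by simpa [h] using h1, h⟩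
      · exact ⟨u, v, Sym2.eq_swap, h, by simpa [h] using h1⟩
    have hmem : ∀ v, v ∈ e.1 ↔ v = t ∨ v = h := fun v => by rw [he, Sym2.mem_iff]
    refine ⟨h, t, he, fun v => ?_, fun v => ?_, ?_, ?_⟩
    · simp only [IsHead, hmem, hσ]
      constructor
      · rintro ⟨rfl | rfl, h'⟩
        · norm_num [ht] at h'
        · rfl
      · rintro rfl
        exact ⟨.inr rfl, .inr ⟨trivial, hh⟩⟩
    · simp only [IsTail, hmem, hσ]
      constructor
      · rintro ⟨rfl | rfl, h'⟩
        · rfl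
        · norm_num [hh] at h'
      · rintro rfl
        exact ⟨.inl rfl, .inr ⟨trivial, ht⟩⟩
    · rw [edgeWeight_of_pos hσ, ht]
    · rw [edgeWeight_of_pos hσ, hh, hσ]
      simp
  · obtain ⟨h, t, he, hlt⟩ : ∃ h t : V, e.1 = s(t, h) ∧ t < h := by
      obtain ⟨⟨u, v⟩, huv⟩ := e
      have hadj : G.Adj u v := huv
      rcases lt_or_gt_of_ne hadj.ne with h | h
      · exact ⟨v, u, rfl, h⟩
      · exact ⟨u, v, Sym2.eq_swap, h⟩
    have hprod := hN.mul_eq t h e he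
    rw [hσ] at hprod
    -- The two entries of a negative edge have product 1, so they are equal, and the weight is their
    -- common value.
    have hw : N t e = edgeWeight σ N e ∧ N h e = edgeWeight σ N e := by
      have hmem : (∀ v ∈ e.1, N v e = -1) ↔ N t e = -1 ∧ N h e = -1 := by
        rw [he]
        simp
      rcases hN.eq_one_or t e (by rw [he]; simp) with h' | h'
      · have h'' : N h e = 1 := by simpa [h'] using hprod
        rw [edgeWeight, hmem, h', h'']
        norm_num
      · have h'' : N h e = -1 := by
          rw [h'] at hprod
          push_cast at hprod
          linarith
        rw [edgeWeight, hmem, h', h'']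
        simp [hσ]
    have hmem : ∀ v, v ∈ e.1 ↔ v = t ∨ v = h := fun v => by rw [he, Sym2.mem_iff]
    have hne : (-1 : ℤˣ) ≠ 1 := by decide
    refine ⟨h, t, he, fun v => ?_, fun v => ?_, hw.1, ?_⟩
    · simp only [IsHead, hmem, hσ, hne, forall_eq_or_imp, forall_eq, true_and, false_and, or_false]
      constructor
      · rintro ⟨rfl | rfl, h'⟩
        · exact absurd h'.2 (not_le.2 hlt)
        · rfl
      · rintro rfl
        exact ⟨.inr rfl, hlt.le, le_rfl⟩
    · simp only [IsTail, hmem, hσ, hne, forall_eq_or_imp, forall_eq, true_and, false_and, or_false]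
      constructor
      · rintro ⟨rfl | rfl, h'⟩
        · rfl
        · exact absurd h'.1 (not_le.2 hlt)
      · rintro rfl
        exact ⟨.inl rfl, le_rfl, hlt.le⟩
    · rw [hw.2, hσ]
      simp

lemma IsIncidenceMatrix.exists_comp_eq [LinearOrder V] (hN : IsIncidenceMatrix G σ N)
    (e : G.edgeSet) : ∃ h t : V, e.1 = s(t, h) ∧ N t e = edgeWeight σ N e ∧
      N h e = edgeWeight σ N e * -((σ e.1 : ℤ) : ℝ) ∧
      ∀ T : SimpleGraph V, headComp σ N T e = {j | (T.deleteEdges {e.1}).Reachable h j} ∧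
        tailComp σ N T e = {j | (T.deleteEdges {e.1}).Reachable t j} := by
  obtain ⟨h, t, he, hh, ht, h1, h2⟩ := hN.exists_head_tail e
  refine ⟨h, t, he, h1, h2, fun T => ?_⟩
  simp [headComp, tailComp, hh, ht]

/-- The entries of `treeInverse` in terms of the incidence matrix, for vertices `j` on the side of
the end `x` of the edge. -/
lemma treeInverse_mul_switching [Fintype V] [DecidableEq V]
    (hM : IsOriented src tgt (Matrix.diagonal (fun v => ((s v : ℤ) : ℝ)) * N))
    (hT : (G.deleteEdges {k}).IsTree) {e : G.edgeSet} (hk : e.1 ≠ k) {x y j : V}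
    (he : e.1 = s(x, y)) (hx : ((G.deleteEdges {k}).deleteEdges {e.1}).Reachable x j) :
    treeInverse src k e j * (s j : ℤ) = N x e * ((s x * s j : ℤˣ) : ℤ) *
      {i | ((G.deleteEdges {k}).deleteEdges {e.1}).Reachable y i}.ncard / Fintype.card V := by
  have hne : Nonempty V := ⟨j⟩
  have hn : (Fintype.card V : ℝ) ≠ 0 := by simp
  have h0 := hM.reachable_tgt_iff_not hT hk
  have hxe := hM.apply x e
  rw [Matrix.diagonal_mul] at hxe
  have hN : N x e = ((s x : ℤ) : ℝ) *
      ((if x = src e then 1 else 0) - if x = tgt e then 1 else 0) := by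
    rw [← hxe, ← mul_assoc, units_cast_mul_self, one_mul]
  have hst := (hM.adj e).ne
  push_cast
  -- The signs cancel by `s x * s x = 1`, leaving a claim about the orientation alone.
  suffices treeInverse src k e j = ((if x = src e then 1 else 0) - if x = tgt e then 1 else 0) *
      {i | ((G.deleteEdges {k}).deleteEdges {e.1}).Reachable y i}.ncard / Fintype.card V by
    rw [this, hN]
    linear_combination (-(((if x = src e then 1 else 0) - if x = tgt e then 1 else 0) *
      ({i | ((G.deleteEdges {k}).deleteEdges {e.1}).Reachable y i}.ncard : ℝ) / Fintype.card V) *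
      (s j : ℤ)) * units_cast_mul_self (s x)
  have he' := hM.edge_eq e
  rw [he] at he'
  rcases Sym2.eq_iff.1 he' with ⟨rfl, rfl⟩ | ⟨rfl, rfl⟩
  -- If `x` is the source, the entry is 1 minus the proportion of vertices on its side, that is, the
  -- proportion on the other side. If `x` is the target, the indicator is 0 and only minus the
  -- proportion on the source side remains.
  · have hcompl : {i | ((G.deleteEdges {k}).deleteEdges {e.1}).Reachable (tgt e) i} =
        {i | ((G.deleteEdges {k}).deleteEdges {e.1}).Reachable (src e) i}ᶜ := by
      ext i
      exact h0 i
    have hcard := Set.ncard_add_ncard_compl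
      {i | ((G.deleteEdges {k}).deleteEdges {e.1}).Reachable (src e) i}
    rw [← hcompl, Nat.card_eq_fintype_card] at hcard
    rw [treeInverse, if_neg hk, if_pos hx, Nat.card_eq_fintype_card, if_pos rfl, if_neg hst,
      ← hcard]
    rw [← hcard] at hn
    push_cast at hn ⊢
    field_simp
    ring
  · rw [treeInverse, if_neg hk, if_neg ((h0 j).1 hx), Nat.card_eq_fintype_card, if_pos rfl,
      if_neg hst.symm]
    ring

/-- The two cases of `treeTerm` are `x = t` and `x = h` in `treeInverse_mul_switching`; the factor
`-σ(e)` is the ratio of the entries of `N` at head and tail. -/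
lemma treeInverse_mul_switching_eq_treeTerm [Fintype V] [LinearOrder V]
    (hN : IsIncidenceMatrix G σ N) (hs : ∀ u v, G.Adj u v → σ s(u, v) = s u * s v)
    (hM : IsOriented src tgt (Matrix.diagonal (fun v => ((s v : ℤ) : ℝ)) * N))
    (hT : (G.deleteEdges {k}).IsTree) {e : G.edgeSet} (hk : e.1 ≠ k) (j : V) :
    treeInverse src k e j * (s j : ℤ) = edgeWeight σ N e / Fintype.card V *
      (edgePathSign σ (G.deleteEdges {k}) e.1 j * treeTerm σ N (G.deleteEdges {k}) e j) := by
  obtain ⟨h, t, he, hNt, hNh, hcomp⟩ := hN.exists_comp_eq e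
  have hadj : (G.deleteEdges {k}).Adj t h := by
    have := e.2
    rw [he] at this hk
    simpa using ⟨this, by simpa using hk⟩
  have hsk : ∀ u v, (G.deleteEdges {k}).Adj u v → σ s(u, v) = s u * s v :=
    fun u v huv => hs u v (G.deleteEdges_le {k} huv)
  have h0 := fun i => reachable_deleteEdges_iff_not hT hadj i
  rw [← he] at h0
  rw [treeTerm, (hcomp _).1, (hcomp _).2]
  by_cases ht : ((G.deleteEdges {k}).deleteEdges {e.1}).Reachable t j
  · rw [treeInverse_mul_switching hM hT hk he ht, edgePathSign_eq (x := t) hsk (by simp [he]) ht,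
      hNt]
    · simp only [Set.mem_ofPred_eq, ht, if_true]
      ring
    · intro u hu huj
      rw [he, Sym2.mem_iff] at hu
      rcases hu with rfl | rfl
      · rfl
      · exact absurd ht ((h0 j).1 huj)
  · have hh := (h0 j).2 ht
    rw [treeInverse_mul_switching hM hT hk (he.trans Sym2.eq_swap) hh,
      edgePathSign_eq (x := h) hsk (by simp [he]) hh, hNh]
    · simp only [Set.mem_ofPred_eq, ht, hh, if_true, if_false]
      ring
    · intro u hu huj
      rw [he, Sym2.mem_iff] at hu
      rcases hu with rfl | rfl
      · exact absurd huj ht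
      · rfl

/-! ### Edges off the cycle and the average over the cycle. -/

section Cycle

variable {c₀ : V} {C : G.Walk c₀ c₀}

/-- An edge outside the only cycle is a bridge. -/
lemma IsUniqueCycle.reachable_deleteEdges_iff_not (hC : IsUniqueCycle C) (hG : G.Connected)
    {e : Sym2 V} (heG : e ∈ G.edgeSet) (heC : e ∉ C.edges) {x y : V} (he : e = s(x, y)) (j : V) :
    (G.deleteEdges {e}).Reachable y j ↔ ¬ (G.deleteEdges {e}).Reachable x j := by
  obtain ⟨k, hk⟩ := hC.exists_mem_edges
  rw [← hC.reachable_deleteEdges_deleteEdges_iff heC hk,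
    ← hC.reachable_deleteEdges_deleteEdges_iff heC hk]
  have hek : e ≠ k := fun h => heC (h ▸ hk)
  subst he
  exact SignedGraph.reachable_deleteEdges_iff_not (hC.isTree_deleteEdges hG hk)
    (by simpa using ⟨heG, by simpa using hek⟩) j

lemma reachable_of_mem_support {e : Sym2 V} (heC : e ∉ C.edges) {u : V} (hu : u ∈ C.support) :
    (G.deleteEdges {e}).Reachable c₀ u := by
  classical
  exact ⟨(C.toDeleteEdge e heC).takeUntil u (by simpa using hu)⟩

lemma mem_cycleSide_iff {e : G.edgeSet} (heC : e.1 ∉ C.edges) {j : V} :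
    j ∈ cycleSide C e ↔ (G.deleteEdges {e.1}).Reachable c₀ j :=
  ⟨fun ⟨_, hu, h⟩ => (reachable_of_mem_support heC hu).trans h,
    fun h => ⟨c₀, C.start_mem_support, h⟩⟩

lemma mem_farSide_iff {e : G.edgeSet} (heC : e.1 ∉ C.edges) {j : V} :
    j ∈ farSide C e ↔ ¬ (G.deleteEdges {e.1}).Reachable c₀ j :=
  ⟨fun h => h c₀ C.start_mem_support,
    fun h _ hu hj => h ((reachable_of_mem_support heC hu).trans hj)⟩

lemma IsUniqueCycle.farSide_eq (hC : IsUniqueCycle C) (hG : G.Connected) {e : G.edgeSet}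
    (heC : e.1 ∉ C.edges) {x y j : V} (he : e.1 = s(x, y)) (hj : j ∈ cycleSide C e)
    (hx : (G.deleteEdges {e.1}).Reachable x j) :
    farSide C e = {i | (G.deleteEdges {e.1}).Reachable y i} := by
  have hc := (mem_cycleSide_iff heC).1 hj
  ext i
  rw [mem_farSide_iff heC, Set.mem_ofPred_eq, hC.reachable_deleteEdges_iff_not hG e.2 heC he]
  exact not_congr ⟨fun h => hx.trans (hc.symm.trans h), fun h => hc.trans (hx.symm.trans h)⟩

lemma IsUniqueCycle.cycleSide_eq (hC : IsUniqueCycle C) (hG : G.Connected) {e : G.edgeSet}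
    (heC : e.1 ∉ C.edges) {x y j : V} (he : e.1 = s(x, y)) (hj : j ∈ farSide C e)
    (hx : (G.deleteEdges {e.1}).Reachable x j) :
    cycleSide C e = {i | (G.deleteEdges {e.1}).Reachable y i} := by
  have hc := (mem_farSide_iff heC).1 hj
  have hy : (G.deleteEdges {e.1}).Reachable y c₀ :=
    (hC.reachable_deleteEdges_iff_not hG e.2 heC he c₀).2 fun h => hc (h.symm.trans hx)
  ext i
  rw [mem_cycleSide_iff heC, Set.mem_ofPred_eq]
  exact ⟨fun h => hy.trans h, fun h => hy.symm.trans h⟩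

/-- The sign of a path between `e` and `j` depends only on the vertices, if `e` is a bridge or a
positive edge. -/
lemma IsUniqueCycle.edgePathSign_eq (hC : IsUniqueCycle C) (hG : G.Connected)
    (hs : ∀ u v, G.Adj u v → σ s(u, v) = s u * s v) {e : G.edgeSet}
    (h : e.1 ∉ C.edges ∨ σ e.1 = 1) {x j : V} (hx : x ∈ e.1)
    (hj : (G.deleteEdges {e.1}).Reachable x j) :
    edgePathSign σ G e.1 j = ((s x * s j : ℤˣ) : ℤ) := by
  refine SignedGraph.edgePathSign_eq hs hx hj fun u hu huj => ?_
  by_cases hux : u = x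
  · rw [hux]
  have he : e.1 = s(x, u) := (Sym2.mem_and_mem_iff (Ne.symm hux)).1 ⟨hx, hu⟩
  rcases h with h | h
  · exact absurd hj ((hC.reachable_deleteEdges_iff_not hG e.2 h he j).1 huj)
  -- The ends of a positive edge have the same value of `s`, so it does not matter where the path
  -- starts.
  · have hadj := e.2
    rw [he] at h hadj
    rw [hs _ _ hadj] at h
    exact (mul_eq_one_iff_eq_inv.1 h).symm ▸ (Int.units_inv_eq_self _).symm

variable [Fintype V]

/-- All trees contribute equally, because `T_k ∖ e` and `G ∖ e` have the same components. -/
lemma IsUniqueCycle.cycleInverse_mul_switching [DecidableEq V] (hC : IsUniqueCycle C)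
    (hG : G.Connected) (hs : ∀ u v, G.Adj u v → σ s(u, v) = s u * s v)
    (hM : IsOriented src tgt (Matrix.diagonal (fun v => ((s v : ℤ) : ℝ)) * N)) {e : G.edgeSet}
    (heC : e.1 ∉ C.edges) {x y j : V} (he : e.1 = s(x, y))
    (hx : (G.deleteEdges {e.1}).Reachable x j) :
    cycleInverse src C e j * (s j : ℤ) = N x e * edgePathSign σ G e.1 j *
      {i | (G.deleteEdges {e.1}).Reachable y i}.ncard / Fintype.card V := by
  have hsum : ∀ k ∈ C.edges.toFinset, treeInverse src k e j * (s j : ℤ) =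
      N x e * edgePathSign σ G e.1 j *
      {i | (G.deleteEdges {e.1}).Reachable y i}.ncard / Fintype.card V := by
    intro k hk
    rw [List.mem_toFinset] at hk
    have hek : e.1 ≠ k := fun h => heC (h ▸ hk)
    have hiff := fun a b => hC.reachable_deleteEdges_deleteEdges_iff heC hk (a := a) (b := b)
    rw [treeInverse_mul_switching hM (hC.isTree_deleteEdges hG hk) hek he ((hiff x j).2 hx),
      hC.edgePathSign_eq hG hs (.inl heC) (by simp [he]) hx]
    simp only [hiff]
  rw [cycleInverse, Matrix.smul_apply, Matrix.sum_apply, smul_eq_mul, mul_assoc, Finset.sum_mul,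
    Finset.sum_congr rfl hsum, Finset.sum_const, hC.card_edges, nsmul_eq_mul,
    inv_mul_cancel_left₀ hC.length_ne_zero]

lemma IsUniqueCycle.cycleInverse_mul_switching_eq_sum [LinearOrder V] (hC : IsUniqueCycle C)
    (hG : G.Connected) (hN : IsIncidenceMatrix G σ N)
    (hs : ∀ u v, G.Adj u v → σ s(u, v) = s u * s v)
    (hM : IsOriented src tgt (Matrix.diagonal (fun v => ((s v : ℤ) : ℝ)) * N)) (e : G.edgeSet)
    (j : V) :
    cycleInverse src C e j * (s j : ℤ) = edgeWeight σ N e / (Fintype.card V * C.length) *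
      ∑ k ∈ C.edges.toFinset with k ≠ e.1,
        edgePathSign σ (G.deleteEdges {k}) e.1 j * treeTerm σ N (G.deleteEdges {k}) e j := by
  rw [cycleInverse, Matrix.smul_apply, Matrix.sum_apply, smul_eq_mul, mul_assoc, Finset.sum_mul,
    Finset.sum_filter, Finset.mul_sum, Finset.mul_sum]
  refine Finset.sum_congr rfl fun k hk => ?_
  rw [List.mem_toFinset] at hk
  by_cases hek : e.1 = k
  · simp [treeInverse_apply_self hek, hek]
  · rw [if_pos (Ne.symm hek), treeInverse_mul_switching_eq_treeTerm hN hs hM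
      (hC.isTree_deleteEdges hG hk) hek, ← mul_assoc, inv_mul_eq_div, div_div]

end Cycle

end Formula

end SignedGraph

/-! ### The theorem. -/

open SignedGraph in
theorem theorem4p2 {V : Type*} [Fintype V] [LinearOrder V]
    (G : SimpleGraph V) [Fintype G.edgeSet] (σ : Sym2 V → ℤˣ)
    (hconn : G.Connected) (hbal : IsBalanced G σ)
    {c₀ : V} (C : G.Walk c₀ c₀) (hC : IsUniqueCycle C)
    (N : Matrix V G.edgeSet ℝ) (hN : IsIncidenceMatrix G σ N) :
    -- an edge off the cycle and a vertex on the cycle side; the spanning trees `T_k` are the graphs `G.deleteEdges {k}`, `k ∈ E(C)`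
    (∀ (e : G.edgeSet) (j : V), e.1 ∉ C.edges → j ∈ cycleSide C e →
      Xor (∀ k ∈ C.edges, j ∈ headComp σ N (G.deleteEdges {k}) e)
        (∀ k ∈ C.edges, j ∈ tailComp σ N (G.deleteEdges {k}) e)) ∧
    -- the sign of `P_{e-j}` in `G` does not depend on the choice of the path,
    -- if `e` is outside the cycle or positive
    (∀ (e : G.edgeSet) (j u : V) (p : G.Walk u j), (e.1 ∉ C.edges ∨ σ e.1 = 1) →
      IsShortestPathFromEdge G e.1 j p →
      ((walkSign σ p : ℤ) : ℝ) = edgePathSign σ G e.1 j) ∧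
    -- the Moore-Penrose inverse `X` of `N` exists, is unique and is given by
    ∃ X : Matrix G.edgeSet V ℝ,
      (∀ Y : Matrix G.edgeSet V ℝ, IsMoorePenroseInverse N Y ↔ Y = X) ∧
      ∀ (e : G.edgeSet) (j : V),
        (e.1 ∉ C.edges → j ∈ cycleSide C e →
          (∃ k ∈ C.edges, j ∈ tailComp σ N (G.deleteEdges {k}) e) →
          X e j = edgeWeight σ N e * edgePathSign σ G e.1 j / (Fintype.card V * C.length) *
            (C.length * (farSide C e).ncard)) ∧
        (e.1 ∉ C.edges → j ∈ cycleSide C e →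
          (∃ k ∈ C.edges, j ∈ headComp σ N (G.deleteEdges {k}) e) →
          X e j = edgeWeight σ N e * edgePathSign σ G e.1 j / (Fintype.card V * C.length) *
            (-((σ e.1 : ℤ) : ℝ) * C.length * (farSide C e).ncard)) ∧
        (e.1 ∉ C.edges → j ∈ farSide C e →
          (∃ k ∈ C.edges, j ∈ tailComp σ N (G.deleteEdges {k}) e) →
          X e j = edgeWeight σ N e * edgePathSign σ G e.1 j / (Fintype.card V * C.length) *
            (C.length * (cycleSide C e).ncard)) ∧
        (e.1 ∉ C.edges → j ∈ farSide C e →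
          (∃ k ∈ C.edges, j ∈ headComp σ N (G.deleteEdges {k}) e) →
          X e j = edgeWeight σ N e * edgePathSign σ G e.1 j / (Fintype.card V * C.length) *
            (-((σ e.1 : ℤ) : ℝ) * C.length * (cycleSide C e).ncard)) ∧
        (e.1 ∈ C.edges →
          X e j = edgeWeight σ N e / (Fintype.card V * C.length) *
            ∑ k ∈ C.edges.toFinset with k ≠ e.1,
              edgePathSign σ (G.deleteEdges {k}) e.1 j *
                treeTerm σ N (G.deleteEdges {k}) e j) ∧
        (e.1 ∈ C.edges → σ e.1 = 1 →
          X e j = edgeWeight σ N e * edgePathSign σ G e.1 j / (Fintype.card V * C.length) *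
            ∑ k ∈ C.edges.toFinset with k ≠ e.1, treeTerm σ N (G.deleteEdges {k}) e j) := by
  have hne : Nonempty V := hconn.nonempty
  have hn : (Fintype.card V : ℝ) ≠ 0 := by simp
  have hl := hC.length_ne_zero
  obtain ⟨s, hs⟩ := hC.exists_switching hconn hbal
  obtain ⟨src, tgt, hM⟩ := hN.exists_isOriented hs
  set S : Matrix V V ℝ := Matrix.diagonal fun v => ((s v : ℤ) : ℝ) with hS
  have hSS : S * S = 1 := by simp [hS, units_cast_mul_self]
  -- `N = S (S N)`, so the inverse of the oriented matrix `S N` is carried back by `S`.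
  have hX : IsMoorePenroseInverse N (cycleInverse src C * S) := by
    have h := (hM.isMoorePenroseInverse_cycleInverse hconn hC).mul_isometry hSS (by simp [hS])
    rwa [← Matrix.mul_assoc, hSS, Matrix.one_mul] at h
  refine ⟨fun e j he hj => ?_, fun e j u p he hp => ?_, cycleInverse src C * S,
    fun Y => ⟨fun hY => hX.unique hY, fun hY => hY ▸ hX⟩, fun e j => ?_⟩
  · obtain ⟨h, t, hte, -, -, hcomp⟩ := hN.exists_comp_eq e
    have hcompl := hC.reachable_deleteEdges_iff_not hconn e.2 he hte j
    have hhead : (∀ k ∈ C.edges, j ∈ headComp σ N (G.deleteEdges {k}) e) ↔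
        (G.deleteEdges {e.1}).Reachable h j := by
      obtain ⟨k₀, hk₀⟩ := hC.exists_mem_edges
      simp only [(hcomp _).1, Set.mem_ofPred_eq]
      exact ⟨fun hj => (hC.reachable_deleteEdges_deleteEdges_iff he hk₀).1 (hj k₀ hk₀),
        fun hj k hk => (hC.reachable_deleteEdges_deleteEdges_iff he hk).2 hj⟩
    have htail : (∀ k ∈ C.edges, j ∈ tailComp σ N (G.deleteEdges {k}) e) ↔
        (G.deleteEdges {e.1}).Reachable t j := by
      obtain ⟨k₀, hk₀⟩ := hC.exists_mem_edges
      simp only [(hcomp _).2, Set.mem_ofPred_eq]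
      exact ⟨fun hj => (hC.reachable_deleteEdges_deleteEdges_iff he hk₀).1 (hj k₀ hk₀),
        fun hj k hk => (hC.reachable_deleteEdges_deleteEdges_iff he hk).2 hj⟩
    rw [hhead, htail, hcompl, Xor]
    tauto
  · rw [hC.edgePathSign_eq hconn hs he hp.1.1 hp.1.reachable, walkSign_eq_mul hs]
  · rw [hS, Matrix.mul_diagonal]
    obtain ⟨h, t, hte, hNt, hNh, hcomp⟩ := hN.exists_comp_eq e
    simp only [(hcomp _).1, (hcomp _).2, Set.mem_ofPred_eq]
    have hht := hte.trans Sym2.eq_swap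
    refine ⟨fun he hj ⟨k, hk, hx⟩ => ?_, fun he hj ⟨k, hk, hx⟩ => ?_, fun he hj ⟨k, hk, hx⟩ => ?_,
      fun he hj ⟨k, hk, hx⟩ => ?_,
      fun he => hC.cycleInverse_mul_switching_eq_sum hconn hN hs hM e j, fun he hσ => ?_⟩
    · rw [hC.reachable_deleteEdges_deleteEdges_iff he hk] at hx
      rw [hC.cycleInverse_mul_switching hconn hs hM he hte hx,
        ← hC.farSide_eq hconn he hte hj hx, hNt]
      field_simp
    · rw [hC.reachable_deleteEdges_deleteEdges_iff he hk] at hx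
      rw [hC.cycleInverse_mul_switching hconn hs hM he hht hx,
        ← hC.farSide_eq hconn he hht hj hx, hNh]
      field_simp
    · rw [hC.reachable_deleteEdges_deleteEdges_iff he hk] at hx
      rw [hC.cycleInverse_mul_switching hconn hs hM he hte hx,
        ← hC.cycleSide_eq hconn he hte hj hx, hNt]
      field_simp
    · rw [hC.reachable_deleteEdges_deleteEdges_iff he hk] at hx
      rw [hC.cycleInverse_mul_switching hconn hs hM he hht hx,
        ← hC.cycleSide_eq hconn he hht hj hx, hNh]
      field_simp
    · have htree := fun k (hk : k ∈ C.edges) => hC.isTree_deleteEdges hconn hk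
      have hst : s h = s t := by
        have hadj := e.2
        rw [hte] at hadj hσ
        rw [hs _ _ hadj] at hσ
        exact (mul_eq_one_iff_eq_inv'.1 hσ).trans (Int.units_inv_eq_self _)
      have hends : ∀ u ∈ e.1, s u = s t := by
        intro u hu
        rw [hte, Sym2.mem_iff] at hu
        rcases hu with rfl | rfl
        · rfl
        · exact hst
      rw [hC.cycleInverse_mul_switching_eq_sum hconn hN hs hM e j, mul_div_right_comm, mul_assoc,
        Finset.mul_sum _ _ (edgePathSign σ G e.1 j)]
      congr 1
      refine Finset.sum_congr rfl fun k hk => ?_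
      rw [Finset.mem_filter, List.mem_toFinset] at hk
      congr 1
      -- In `G ∖ e`, connected since `e` is on the cycle, the tail reaches `j`. In `T_k ∖ e` perhaps
      -- only the head does, but `s` agrees on both ends, so the two path signs coincide.
      rw [hC.edgePathSign_eq hconn hs (.inr hσ) (x := t) (by simp [hte])
        ((htree _ he).connected.preconnected t j)]
      have hsk : ∀ u v, (G.deleteEdges {k}).Adj u v → σ s(u, v) = s u * s v :=
        fun u v huv => hs u v (G.deleteEdges_le {k} huv)
      have hx : ∃ x ∈ e.1, ((G.deleteEdges {k}).deleteEdges {e.1}).Reachable x j := by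
        rw [hte]
        rcases reachable_deleteEdges_or (htree k hk.1).connected.preconnected t h j with hx | hx
        · exact ⟨t, by simp, hx⟩
        · exact ⟨h, by simp, hx⟩
      obtain ⟨x, hxe, hx⟩ := hx
      rw [SignedGraph.edgePathSign_eq hsk hxe hx fun u hu _ => (hends u hu).trans (hends x hxe).symm,
        hends x hxe]
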